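/- Let $\mathcal V$ be a monoidal model category: a complete and cocomplete symmetric monoidal closed category with a model structure whose tensor product satisfies the pushout-product axiom and whose unit object $I$ is cofibrant. Suppose that $\mathcal V$ satisfies the monoid axiom (every transfinite composite of pushouts of maps $f\otimes Z$, with $f$ a trivial cofibration and $Z\in\mathcal V$, is a weak equivalence). Let $\mathcal M$ be a model $\mathcal V$-category: a $\mathcal V$-category with all small weighted limits and colimits, with a model structure on its underlying ordinary category, such that for cofibrations $j\colon X\to Y$ in $\mathcal V$ and $f\colon A\to B$ in $\mathcal M$ the induced map $j\,\square\, f\colon (Y\cdot A)\amalg_{X\cdot A}(X\cdot B)\to Y\cdot B$ is a cofibration, trivial if $j$ or $f$ is. Let $\operatorname{Int}\mathcal M$ be the full sub-$\mathcal V$-category of objects that are both fibrant and cofibrant. For a small $\mathcal V$-category $\mathcal D$, call a $\mathcal V$-functor $G\colon\mathcal D^{\mathrm{op}}\to\mathcal V$ (or $G\colon\mathcal D\to\mathcal V$) a cofibrant weight if it is projectively cofibrant, i.e. has the left lifting property with respect to the pointwise trivial fibrations. In a $\mathcal V$-category $\mathcal K$ with fibrant hom-objects, a homotopy colimit of $S\colon\mathcal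 D\to\mathcal K$ weighted by a cofibrant $G\colon\mathcal D^{\mathrm{op}}\to\mathcal V$ is an object $G*_hS$ with a $\mathcal V$-natural transformation $\mathcal K(G*_hS,-)\to[\mathcal D^{\mathrm{op}},\mathcal V](G,\mathcal K(S,-))$ whose components are weak equivalences. Dually, a homotopy limit of $S$ weighted by a cofibrant $G\colon\mathcal D\to\mathcal V$ is an object $\{G,S\}_h$ with a $\mathcal V$-natural transformation $\mathcal K(-,\{G,S\}_h)\to[\mathcal D,\mathcal V](G,\mathcal K(-,S))$ whose components are weak equivalences. **Theorem.** The hom-objects of $\operatorname{Int}\mathcal M$ are fibrant, and $\operatorname{Int}\mathcal M$ has all weighted homotopy colimits and all weighted homotopy limits (for every small $\mathcal D$, every diagram $S\colon\mathcal D\to\operatorname{Int}\mathcal M$ and every cofibrant weight $G$). Moreover: 1. if $G*S$ is a weighted colimit of $S$ in $\mathcal M$ and $r\colon G*S\to R$ is a trivial cofibration with $R$ fibrant, then $R\in\operatorname{Int}\mathcal M$, and the composites $\mathcal M(R,A)\xrightarrow{\mathcal M(r,A)}\mathcal M(G*S,A)\cong[\mathcal D^{\mathrm{op}},\mathcal V](G,\mathcal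 M(S,A))$, for $A\in\operatorname{Int}\mathcal M$, exhibit $R$ as the homotopy colimit $G*_hS$ in $\operatorname{Int}\mathcal M$; 2. if $\{G,S\}$ is a weighted limit of $S$ in $\mathcal M$ and $q\colon Q\to\{G,S\}$ is a trivial fibration with $Q$ cofibrant, then $Q\in\operatorname{Int}\mathcal M$, and the composites $\mathcal M(A,Q)\xrightarrow{\mathcal M(A,q)}\mathcal M(A,\{G,S\})\cong[\mathcal D,\mathcal V](G,\mathcal M(A,S))$, for $A\in\operatorname{Int}\mathcal M$, exhibit $Q$ as the homotopy limit $\{G,S\}_h$ in $\operatorname{Int}\mathcal M$. -/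

import Mathlib

open CategoryTheory MonoidalCategory Limits HomotopicalAlgebra Opposite

attribute [local instance] MonoidalClosed.enrichedCategorySelf
  MonoidalClosed.enrichedOrdinaryCategorySelf

universe v u u₁ u₂ v₂

namespace EnrichedHomotopy

noncomputable section

set_option linter.unusedSectionVars false

section Enriched

/-- The hom-object `K(X, Y)` of a `V`-category `K`. -/
abbrev vhom (V : Type u) [Category.{v} V] [MonoidalCategory V] {K : Type u₁}
    [EnrichedCategory V K] (X Y : K) : V :=
  EnrichedCategory.Hom X Y

section Comp

variable {V : Type u} [Category.{v} V] [MonoidalCategory V] {K : Type u₁} [EnrichedCategory V K]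

theorem assoc_inv_eComp {W X Y Z : K} {P Q R : V} (f : P ⟶ vhom V W X) (g : Q ⟶ vhom V X Y)
    (h : R ⟶ vhom V Y Z) :
    (α_ P Q R).inv ≫ (((f ⊗ₘ g) ≫ eComp V W X Y) ⊗ₘ h) ≫ eComp V W Y Z =
      (f ⊗ₘ ((g ⊗ₘ h) ≫ eComp V X Y Z)) ≫ eComp V W X Z := by
  rw [← tensorHom_comp_whiskerRight_assoc, ← associator_inv_naturality_assoc, e_assoc,
    tensorHom_comp_whiskerLeft_assoc]

theorem assoc_hom_eComp {W X Y Z : K} {P Q R : V} (f : P ⟶ vhom V W X) (g : Q ⟶ vhom V X Y)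
    (h : R ⟶ vhom V Y Z) :
    (((f ⊗ₘ g) ≫ eComp V W X Y) ⊗ₘ h) ≫ eComp V W Y Z =
      (α_ P Q R).hom ≫ (f ⊗ₘ ((g ⊗ₘ h) ≫ eComp V X Y Z)) ≫ eComp V W X Z := by
  rw [← assoc_inv_eComp, Iso.hom_inv_id_assoc]

theorem eId_tensor_eComp {X Y : K} {P : V} (f : P ⟶ vhom V X Y) :
    (eId V X ⊗ₘ f) ≫ eComp V X X Y = (λ_ P).hom ≫ f := by
  rw [MonoidalCategory.tensorHom_def'_assoc, ← leftUnitor_naturality]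
  congr 1
  rw [← Iso.inv_comp_eq_id]
  exact e_id_comp V X Y

theorem tensor_eId_eComp {X Y : K} {P : V} (f : P ⟶ vhom V X Y) :
    (f ⊗ₘ eId V Y) ≫ eComp V X Y Y = (ρ_ P).hom ≫ f := by
  rw [MonoidalCategory.tensorHom_def_assoc, ← rightUnitor_naturality]
  congr 1
  rw [← Iso.inv_comp_eq_id]
  exact e_comp_id V X Y

end Comp

variable {V : Type u} [Category.{v} V] [MonoidalCategory V] [MonoidalClosed V]

/-- The transpose `Y ⟶ [A, X]` of a morphism `A ⊗ Y ⟶ X`. -/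
def ecurry {A Y X : V} (f : A ⊗ Y ⟶ X) : Y ⟶ vhom V A X :=
  MonoidalClosed.curry f

theorem comp_ecurry {A Y Z X : V} (g : Z ⟶ Y) (f : A ⊗ Y ⟶ X) :
    g ≫ ecurry f = ecurry (A ◁ g ≫ f) :=
  (MonoidalClosed.curry_natural_left g f).symm

theorem ecurry_injective {A Y X : V} {f g : A ⊗ Y ⟶ X} (h : ecurry f = ecurry g) : f = g :=
  MonoidalClosed.curry_injective h

theorem eId_eq_ecurry (A : V) : eId V A = ecurry (ρ_ A).hom := rfl

theorem ecurry_eComp {A B C Y Z : V} (f : A ⊗ Y ⟶ B) (g : B ⊗ Z ⟶ C) :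
    (ecurry f ⊗ₘ ecurry g) ≫ eComp V A B C = ecurry ((α_ _ _ _).inv ≫ f ▷ Z ≫ g) := by
  change (MonoidalClosed.curry f ⊗ₘ MonoidalClosed.curry g) ≫
    MonoidalClosed.curry (MonoidalClosed.compTranspose A B C) = MonoidalClosed.curry _
  rw [← MonoidalClosed.curry_natural_left]
  congr 1
  rw [MonoidalClosed.compTranspose_eq, MonoidalCategory.tensorHom_def,
    MonoidalCategory.whiskerLeft_comp, Category.assoc,
    associator_inv_naturality_right_assoc, associator_inv_naturality_middle_assoc,
    whisker_exchange_assoc,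
    ← comp_whiskerRight_assoc, MonoidalClosed.whiskerLeft_curry_ihom_ev_app]
  exact congrArg (fun t => (α_ A Y Z).inv ≫ f ▷ Z ≫ t)
    (MonoidalClosed.whiskerLeft_curry_ihom_ev_app B _ g)

/-- The covariant representable `V`-functor `K(X, -) : K ⥤ V`. -/
abbrev corep {K : Type u₁} [EnrichedCategory V K] (X : K) : EnrichedFunctor V K V where
  obj Y := vhom V X Y
  map Y Z := ecurry (eComp V X Y Z)
  map_id Y := by
    rw [eId_eq_ecurry, comp_ecurry]
    congr 1
    rw [← cancel_epi (ρ_ (vhom V X Y)).inv, Iso.inv_hom_id]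
    exact e_comp_id V X Y
  map_comp Y Z W := by
    rw [ecurry_eComp, comp_ecurry, e_assoc]

variable [SymmetricCategory V]

/-- The opposite of a `V`-functor. -/
def opFunctor {D : Type u₁} {K : Type u₂} [EnrichedCategory V D] [EnrichedCategory V K]
    (S : EnrichedFunctor V D K) : EnrichedFunctor V Dᵒᵖ Kᵒᵖ where
  obj d := op (S.obj d.unop)
  map d e := S.map e.unop d.unop
  map_id d := S.map_id d.unop
  map_comp d e f := by
    rw [tensorHom_eComp_op_eq, eComp_op_eq, Category.assoc, S.map_comp]
    rfl

/-- The `V`-functor `K(S-, X) : Dᵒᵖ ⥤ V`. -/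
def homFrom {D : Type u₁} {K : Type u₂} [EnrichedCategory V D] [EnrichedCategory V K]
    (S : EnrichedFunctor V D K) (X : K) : EnrichedFunctor V Dᵒᵖ V :=
  (opFunctor S).comp V (corep (op X))

/-- The `V`-functor `K(X, S-) : D ⥤ V`. -/
def homTo {D : Type u₁} {K : Type u₂} [EnrichedCategory V D] [EnrichedCategory V K]
    (S : EnrichedFunctor V D K) (X : K) : EnrichedFunctor V D V :=
  S.comp V (corep X)

section NatTransObj

variable [HasLimits V] {A : Type v} [EnrichedCategory V A] (F G : EnrichedFunctor V A V)

/-- The product of the internal homs `[F a, G a]`. -/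
def natProd : V := ∏ᶜ fun a : A => vhom V (F.obj a) (G.obj a)

/-- The projections of this product. -/
def natProdπ (a : A) : natProd F G ⟶ vhom V (F.obj a) (G.obj a) :=
  Pi.π (fun a : A => vhom V (F.obj a) (G.obj a)) a

/-- The map into this product induced by a family of maps. -/
def natProdLift {T : V} (σ : ∀ a : A, T ⟶ vhom V (F.obj a) (G.obj a)) : T ⟶ natProd F G :=
  Pi.lift σ

theorem natProdLift_π {T : V} (σ : ∀ a : A, T ⟶ vhom V (F.obj a) (G.obj a)) (a : A) :
    natProdLift F G σ ≫ natProdπ F G a = σ a :=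
  Pi.lift_π σ a

/-- The first of the two maps whose equalizer is the object of `V`-natural transformations:
`(σ a)` is sent to the transposes of the composites
`A(a, b) ⊗ 1 ⟶ [F a, G a] ⊗ [G a, G b] ⟶ [F a, G b]`. -/
def natLeg₁ : natProd F G ⟶
    ∏ᶜ fun p : A × A => vhom V (vhom V p.1 p.2) (vhom V (F.obj p.1) (G.obj p.2)) :=
  Pi.lift fun p => ecurry
    ((β_ _ _).hom ≫ (natProdπ F G p.1 ⊗ₘ G.map p.1 p.2) ≫
      eComp V (F.obj p.1) (G.obj p.1) (G.obj p.2))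

/-- The second of these two maps: `(σ a)` is sent to the transposes of the composites
`A(a, b) ⊗ 1 ⟶ [F a, F b] ⊗ [F b, G b] ⟶ [F a, G b]`. -/
def natLeg₂ : natProd F G ⟶
    ∏ᶜ fun p : A × A => vhom V (vhom V p.1 p.2) (vhom V (F.obj p.1) (G.obj p.2)) :=
  Pi.lift fun p => ecurry
    ((F.map p.1 p.2 ⊗ₘ natProdπ F G p.2) ≫ eComp V (F.obj p.1) (F.obj p.2) (G.obj p.2))

/-- The hom-object `[A, V](F, G)` of the `V`-category of `V`-functors on a small `V`-category `A`,
that is, the end of the internal homs `[F a, G a]`. -/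
def natObj : V := equalizer (natLeg₁ F G) (natLeg₂ F G)

/-- The inclusion of this end into the product. -/
def natObjι : natObj F G ⟶ natProd F G := equalizer.ι (natLeg₁ F G) (natLeg₂ F G)

theorem natObjι_condition : natObjι F G ≫ natLeg₁ F G = natObjι F G ≫ natLeg₂ F G :=
  equalizer.condition _ _

/-- The projections `[A, V](F, G) ⟶ [F a, G a]` of this end. -/
def natObjπ (a : A) : natObj F G ⟶ vhom V (F.obj a) (G.obj a) :=
  natObjι F G ≫ natProdπ F G a

variable {F G}

/-- A family `σ a : T ⟶ [F a, G a]` is natural if it is a `T`-graded natural transformation. -/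
def IsNatFamily {T : V} (σ : ∀ a : A, T ⟶ vhom V (F.obj a) (G.obj a)) : Prop :=
  ∀ a b : A, (β_ (vhom V a b) T).hom ≫ (σ a ⊗ₘ G.map a b) ≫ eComp V _ _ _ =
    (F.map a b ⊗ₘ σ b) ≫ eComp V _ _ _

theorem isNatFamily_iff {T : V} (f : T ⟶ natProd F G) :
    IsNatFamily (fun a => f ≫ natProdπ F G a) ↔ f ≫ natLeg₁ F G = f ≫ natLeg₂ F G := by
  have key (a b : A) : (β_ (vhom V a b) T).hom ≫ ((f ≫ natProdπ F G a) ⊗ₘ G.map a b) ≫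
      eComp V (F.obj a) (G.obj a) (G.obj b) = vhom V a b ◁ f ≫ (β_ _ _).hom ≫
        (natProdπ F G a ⊗ₘ G.map a b) ≫ eComp V (F.obj a) (G.obj a) (G.obj b) := by
    rw [BraidedCategory.braiding_naturality_right_assoc, whiskerRight_comp_tensorHom_assoc]
  have key' (a b : A) : (F.map a b ⊗ₘ (f ≫ natProdπ F G b)) ≫
      eComp V (F.obj a) (F.obj b) (G.obj b) = vhom V a b ◁ f ≫
        (F.map a b ⊗ₘ natProdπ F G b) ≫ eComp V (F.obj a) (F.obj b) (G.obj b) := by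
    rw [whiskerLeft_comp_tensorHom_assoc]
  constructor
  · intro h
    apply Pi.hom_ext
    rintro ⟨a, b⟩
    simp only [natLeg₁, natLeg₂, Category.assoc, Pi.lift_π]
    rw [comp_ecurry, comp_ecurry, ← key, ← key']
    exact congrArg _ (h a b)
  · intro h a b
    have h' := congr($h ≫ Pi.π _ (a, b))
    simp only [natLeg₁, natLeg₂, Category.assoc, Pi.lift_π] at h'
    rw [comp_ecurry, comp_ecurry, ← key, ← key'] at h'
    exact ecurry_injective h'

theorem natObj_hom_ext {T : V} {f g : T ⟶ natObj F G}
    (h : ∀ a, f ≫ natObjπ F G a = g ≫ natObjπ F G a) : f = g := by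
  have h' : f ≫ natObjι F G = g ≫ natObjι F G := by
    apply Pi.hom_ext
    intro a
    exact (Category.assoc _ _ _).trans ((h a).trans (Category.assoc _ _ _).symm)
  exact equalizer.hom_ext h'

theorem isNatFamily_comp_π {T : V} (f : T ⟶ natObj F G) :
    IsNatFamily (fun a => f ≫ natObjπ F G a) := by
  have := (isNatFamily_iff (f ≫ natObjι F G)).2
    (by rw [Category.assoc, natObjι_condition, Category.assoc])
  simpa only [natObjπ, Category.assoc] using this

/-- The universal property of the end: a natural family induces a map into it. -/
def natObjLift {T : V} (σ : ∀ a : A, T ⟶ vhom V (F.obj a) (G.obj a)) (h : IsNatFamily σ) :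
    T ⟶ natObj F G :=
  equalizer.lift (natProdLift F G σ) ((isNatFamily_iff (natProdLift F G σ)).1 (by
    simpa only [natProdLift_π] using h))

theorem natObjLift_π {T : V} (σ : ∀ a : A, T ⟶ vhom V (F.obj a) (G.obj a))
    (h : IsNatFamily σ) (a : A) : natObjLift σ h ≫ natObjπ F G a = σ a := by
  have h₁ : natObjLift σ h ≫ natObjι F G = natProdLift F G σ := equalizer.lift_ι _ _
  rw [natObjπ, ← Category.assoc, h₁, natProdLift_π]

theorem isNatFamily_id : IsNatFamily (F := F) (G := F) (fun a => eId V (F.obj a)) := by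
  intro a b
  rw [eId_tensor_eComp, tensor_eId_eComp, braiding_leftUnitor_assoc]

theorem isNatFamily_comp {F G H : EnrichedFunctor V A V} {T T' : V}
    {σ : ∀ a : A, T ⟶ vhom V (F.obj a) (G.obj a)} (hσ : IsNatFamily σ)
    {τ : ∀ a : A, T' ⟶ vhom V (G.obj a) (H.obj a)} (hτ : IsNatFamily τ) :
    IsNatFamily (F := F) (G := H)
      (fun a => (σ a ⊗ₘ τ a) ≫ eComp V (F.obj a) (G.obj a) (H.obj a)) := by
  intro a b
  have hσ' := hσ a b
  have hτ' := hτ a b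
  have h₁ : (F.map a b ⊗ₘ ((σ b ⊗ₘ τ b) ≫ eComp V (F.obj b) (G.obj b) (H.obj b))) ≫
      eComp V (F.obj a) (F.obj b) (H.obj b) =
      (α_ _ _ _).inv ≫ (((F.map a b ⊗ₘ σ b) ≫ eComp V (F.obj a) (F.obj b) (G.obj b)) ⊗ₘ τ b) ≫
      eComp V (F.obj a) (G.obj b) (H.obj b) :=
    (assoc_inv_eComp _ _ _).symm
  have h₂ : (((β_ (vhom V a b) T).hom ≫ (σ a ⊗ₘ G.map a b) ≫
        eComp V (F.obj a) (G.obj a) (G.obj b)) ⊗ₘ τ b) ≫ eComp V (F.obj a) (G.obj b) (H.obj b) =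
      (β_ (vhom V a b) T).hom ▷ T' ≫ (α_ _ _ _).hom ≫ (σ a ⊗ₘ ((G.map a b ⊗ₘ τ b) ≫
        eComp V (G.obj a) (G.obj b) (H.obj b))) ≫ eComp V (F.obj a) (G.obj a) (H.obj b) := by
    rw [← assoc_hom_eComp, whiskerRight_comp_tensorHom_assoc]
  have h₃ : (σ a ⊗ₘ ((β_ (vhom V a b) T').hom ≫ (τ a ⊗ₘ H.map a b) ≫
        eComp V (G.obj a) (H.obj a) (H.obj b))) ≫ eComp V (F.obj a) (G.obj a) (H.obj b) =
      T ◁ (β_ (vhom V a b) T').hom ≫ (α_ _ _ _).inv ≫ (((σ a ⊗ₘ τ a) ≫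
        eComp V (F.obj a) (G.obj a) (H.obj a)) ⊗ₘ H.map a b) ≫
        eComp V (F.obj a) (H.obj a) (H.obj b) := by
    rw [assoc_inv_eComp, whiskerLeft_comp_tensorHom_assoc]
  rw [h₁, ← hσ', h₂, ← hτ', h₃, BraidedCategory.braiding_tensor_right_hom]
  simp only [Category.assoc]

variable (F G) in
/-- The identity of `F` in the `V`-category of `V`-functors. -/
def natObjId : 𝟙_ V ⟶ natObj F F := natObjLift _ isNatFamily_id

/-- Composition in the `V`-category of `V`-functors. -/
def natObjComp (F G H : EnrichedFunctor V A V) : natObj F G ⊗ natObj G H ⟶ natObj F H :=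
  natObjLift (fun a => (natObjπ F G a ⊗ₘ natObjπ G H a) ≫ eComp V (F.obj a) (G.obj a) (H.obj a))
    (by
      have h₁ := isNatFamily_comp_π (𝟙 (natObj F G))
      have h₂ := isNatFamily_comp_π (𝟙 (natObj G H))
      simp only [Category.id_comp] at h₁ h₂
      exact isNatFamily_comp h₁ h₂)

theorem natObjId_π (a : A) : natObjId F ≫ natObjπ F F a = eId V (F.obj a) :=
  natObjLift_π _ _ a

theorem natObjComp_π (F G H : EnrichedFunctor V A V) (a : A) :
    natObjComp F G H ≫ natObjπ F H a =
      (natObjπ F G a ⊗ₘ natObjπ G H a) ≫ eComp V (F.obj a) (G.obj a) (H.obj a) :=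
  natObjLift_π _ _ a

/-- The `V`-category `[A, V]` of `V`-functors on a small `V`-category `A`. -/
instance functorCategory : EnrichedCategory V (EnrichedFunctor V A V) where
  Hom F G := natObj F G
  id F := natObjId F
  comp F G H := natObjComp F G H
  id_comp F G := by
    apply natObj_hom_ext
    intro a
    rw [Category.assoc, Category.assoc, natObjComp_π, whiskerRight_comp_tensorHom_assoc,
      natObjId_π, eId_tensor_eComp, Iso.inv_hom_id_assoc, Category.id_comp]
  comp_id F G := by
    apply natObj_hom_ext
    intro a
    rw [Category.assoc, Category.assoc, natObjComp_π, whiskerLeft_comp_tensorHom_assoc,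
      natObjId_π, tensor_eId_eComp, Iso.inv_hom_id_assoc, Category.id_comp]
  assoc F G H K := by
    apply natObj_hom_ext
    intro a
    simp only [Category.assoc]
    rw [natObjComp_π, natObjComp_π, whiskerRight_comp_tensorHom_assoc,
      whiskerLeft_comp_tensorHom_assoc, natObjComp_π, natObjComp_π, assoc_inv_eComp]

end NatTransObj

section HomFunctors

variable [HasLimits V] {D : Type v} [EnrichedCategory V D] {K : Type u₁} [EnrichedCategory V K]

/-- Post-composition `K(X, Y) ⟶ [K(S d, X), K(S d, Y)]`. -/
def homFromApp (S : EnrichedFunctor V D K) (X Y : K) (d : Dᵒᵖ) :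
    vhom V X Y ⟶ vhom V ((homFrom S X).obj d) ((homFrom S Y).obj d) :=
  ecurry (eComp V (S.obj d.unop) X Y)

theorem isNatFamily_homFromApp (S : EnrichedFunctor V D K) (X Y : K) :
    IsNatFamily (homFromApp S X Y) := by
  intro d e
  change (β_ (vhom V e.unop d.unop) (vhom V X Y)).hom ≫
    (ecurry (eComp V (S.obj d.unop) X Y) ⊗ₘ (S.map e.unop d.unop ≫
      ecurry ((β_ _ _).hom ≫ eComp V (S.obj e.unop) (S.obj d.unop) Y))) ≫ eComp V _ _ _ =
    ((S.map e.unop d.unop ≫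
      ecurry ((β_ _ _).hom ≫ eComp V (S.obj e.unop) (S.obj d.unop) X)) ⊗ₘ
        ecurry (eComp V (S.obj e.unop) X Y)) ≫ eComp V _ _ _
  rw [comp_ecurry, comp_ecurry, ecurry_eComp, ecurry_eComp, comp_ecurry]
  congr 1
  rw [BraidedCategory.braiding_naturality_right_assoc,
    BraidedCategory.braiding_naturality_right_assoc,
    BraidedCategory.braiding_naturality_left_assoc]
  simp only [comp_whiskerRight, Category.assoc]
  rw [← e_assoc', associator_naturality_left_assoc, ← whisker_exchange_assoc,
    BraidedCategory.braiding_tensor_left_hom]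
  simp only [Category.assoc, Iso.inv_hom_id_assoc]
  rw [← MonoidalCategory.whiskerLeft_comp_assoc, SymmetricCategory.symmetry,
    MonoidalCategory.whiskerLeft_id, Category.id_comp]

/-- The action `K(X, Y) ⟶ [Dᵒᵖ, V](K(S-, X), K(S-, Y))` of `K(S, -)` on hom-objects. -/
def homFromMap (S : EnrichedFunctor V D K) (X Y : K) :
    vhom V X Y ⟶ natObj (homFrom S X) (homFrom S Y) :=
  natObjLift _ (isNatFamily_homFromApp S X Y)

theorem homFromMap_π (S : EnrichedFunctor V D K) (X Y : K) (d : Dᵒᵖ) :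
    homFromMap S X Y ≫ natObjπ _ _ d = homFromApp S X Y d :=
  natObjLift_π _ _ d

/-- The `V`-functor `K(S, -) : K ⥤ [Dᵒᵖ, V]`, sending `X` to the presheaf `K(S-, X)`. -/
def presheafFunctor (S : EnrichedFunctor V D K) :
    EnrichedFunctor V K (EnrichedFunctor V Dᵒᵖ V) where
  obj X := homFrom S X
  map X Y := homFromMap S X Y
  map_id X := by
    apply natObj_hom_ext
    intro d
    rw [Category.assoc, homFromMap_π]
    exact ((corep (S.obj d.unop)).map_id X).trans (natObjId_π (F := homFrom S X) d).symm
  map_comp X Y Z := by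
    apply natObj_hom_ext
    intro d
    rw [Category.assoc, homFromMap_π]
    change _ = ((homFromMap S X Y ⊗ₘ homFromMap S Y Z) ≫ natObjComp _ _ _) ≫ _
    rw [Category.assoc, natObjComp_π, tensorHom_comp_tensorHom_assoc, homFromMap_π, homFromMap_π]
    exact (corep (S.obj d.unop)).map_comp X Y Z

/-- Pre-composition `K(X, Y) ⟶ [K(Y, S d), K(X, S d)]`. -/
def homToApp (S : EnrichedFunctor V D K) (X Y : K) (d : D) :
    vhom V X Y ⟶ vhom V ((homTo S Y).obj d) ((homTo S X).obj d) :=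
  ecurry ((β_ _ _).hom ≫ eComp V X Y (S.obj d))

theorem isNatFamily_homToApp (S : EnrichedFunctor V D K) (X Y : K) :
    IsNatFamily (homToApp S X Y) := by
  intro d e
  change (β_ (vhom V d e) (vhom V X Y)).hom ≫
    (ecurry ((β_ _ _).hom ≫ eComp V X Y (S.obj d)) ⊗ₘ (S.map d e ≫
      ecurry (eComp V X (S.obj d) (S.obj e)))) ≫ eComp V _ _ _ =
    ((S.map d e ≫ ecurry (eComp V Y (S.obj d) (S.obj e))) ⊗ₘ
        ecurry ((β_ _ _).hom ≫ eComp V X Y (S.obj e))) ≫ eComp V _ _ _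
  rw [comp_ecurry, comp_ecurry, ecurry_eComp, ecurry_eComp, comp_ecurry]
  congr 1
  rw [BraidedCategory.braiding_naturality_left_assoc, MonoidalCategory.whiskerLeft_comp,
    Category.assoc, ← e_assoc, associator_inv_naturality_right_assoc,
    BraidedCategory.braiding_tensor_left_hom]
  simp only [comp_whiskerRight, Category.assoc, Iso.inv_hom_id_assoc, Iso.hom_inv_id_assoc]
  rw [whisker_exchange_assoc]

/-- The action `K(X, Y) ⟶ [D, V](K(Y, S-), K(X, S-))` of `K(-, S)` on hom-objects. -/
def homToMap (S : EnrichedFunctor V D K) (X Y : K) :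
    vhom V X Y ⟶ natObj (homTo S Y) (homTo S X) :=
  natObjLift _ (isNatFamily_homToApp S X Y)

theorem homToMap_π (S : EnrichedFunctor V D K) (X Y : K) (d : D) :
    homToMap S X Y ≫ natObjπ _ _ d = homToApp S X Y d :=
  natObjLift_π _ _ d

/-- The `V`-functor `K(-, S) : Kᵒᵖ ⥤ [D, V]`, sending `X` to the `V`-functor `K(X, S-)`. -/
def copresheafFunctor (S : EnrichedFunctor V D K) :
    EnrichedFunctor V Kᵒᵖ (EnrichedFunctor V D V) where
  obj X := homTo S X.unop
  map X Y := homToMap S Y.unop X.unop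
  map_id X := by
    apply natObj_hom_ext
    intro d
    rw [Category.assoc, homToMap_π]
    exact ((corep (op (S.obj d))).map_id X).trans (natObjId_π (F := homTo S X.unop) d).symm
  map_comp X Y Z := by
    apply natObj_hom_ext
    intro d
    rw [Category.assoc, homToMap_π]
    change _ = ((homToMap S Y.unop X.unop ⊗ₘ homToMap S Z.unop Y.unop) ≫ natObjComp _ _ _) ≫ _
    rw [Category.assoc, natObjComp_π, tensorHom_comp_tensorHom_assoc, homToMap_π, homToMap_π]
    exact (corep (op (S.obj d))).map_comp X Y Z

end HomFunctors

/-- A `V`-natural transformation between `V`-functors `F, G : A ⥤ V`; the naturality condition is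
an equation between morphisms `A(a, b) ⟶ [F a, G b]` of `V`. -/
structure VNatTrans {A : Type u₁} [EnrichedCategory V A] (F G : EnrichedFunctor V A V) where
  /-- the components -/
  app (a : A) : F.obj a ⟶ G.obj a
  naturality (a b : A) : F.map a b ≫ eHomWhiskerLeft V (F.obj a) (app b) =
    G.map a b ≫ eHomWhiskerRight V (app a) (G.obj b)

section Weighted

variable [HasLimits V] {D : Type v} [EnrichedCategory V D] {K : Type u₁} [EnrichedCategory V K]

/-- The `V`-functor `[Dᵒᵖ, V](G, K(S, -)) : K ⥤ V`. -/
def weightedCocones (G : EnrichedFunctor V Dᵒᵖ V) (S : EnrichedFunctor V D K) : EnrichedFunctor V K V :=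
  (presheafFunctor S).comp V (corep G)

/-- The `V`-functor `[D, V](G, K(-, S)) : Kᵒᵖ ⥤ V`. -/
def weightedCones (G : EnrichedFunctor V D V) (S : EnrichedFunctor V D K) : EnrichedFunctor V Kᵒᵖ V :=
  (copresheafFunctor S).comp V (corep G)

/-- `β : K(C, -) ⟶ [Dᵒᵖ, V](G, K(S, -))` exhibits `C` as the weighted colimit `G * S`. -/
def IsWeightedColimit {G : EnrichedFunctor V Dᵒᵖ V} {S : EnrichedFunctor V D K} {C : K}
    (β : VNatTrans (corep C) (weightedCocones G S)) : Prop :=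
  ∀ X : K, IsIso (β.app X)

/-- `β : K(-, L) ⟶ [D, V](G, K(-, S))` exhibits `L` as the weighted limit `{G, S}`. -/
def IsWeightedLimit {G : EnrichedFunctor V D V} {S : EnrichedFunctor V D K} {L : K}
    (β : VNatTrans (corep (op L)) (weightedCones G S)) : Prop :=
  ∀ X : Kᵒᵖ, IsIso (β.app X)

end Weighted

end Enriched

section Model

variable (V : Type u) [Category.{v} V] [MonoidalCategory V] [SymmetricCategory V]
  [ModelCategory V]

/-- The unit is cofibrant and the tensor product satisfies the pushout-product axiom. -/
class MonoidalModelCategory : Prop where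
  unit_cofibrant : IsCofibrant (𝟙_ V)
  cofibration_pushoutProduct {X Y A B : V} (i : X ⟶ Y) (j : A ⟶ B) [Cofibration i]
    [Cofibration j] (sq : (curriedTensor V).PushoutObjObj i j) : Cofibration sq.ι
  weakEquivalence_pushoutProduct {X Y A B : V} (i : X ⟶ Y) (j : A ⟶ B) [Cofibration i]
    [Cofibration j] (sq : (curriedTensor V).PushoutObjObj i j)
    (h : WeakEquivalence i ∨ WeakEquivalence j) : WeakEquivalence sq.ι

/-- The class of morphisms `f ▷ Z`, for `f` a trivial cofibration and `Z` an object. -/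
inductive tensoredTrivialCofibrations : MorphismProperty V
  | mk {X Y : V} (f : X ⟶ Y) (Z : V) (hf : trivialCofibrations V f) :
      tensoredTrivialCofibrations (f ▷ Z)

/-- The monoid axiom: every transfinite composition of pushouts of morphisms `f ▷ Z`, for `f` a
trivial cofibration, is a weak equivalence. -/
class MonoidAxiom : Prop where
  le_weakEquivalences :
    MorphismProperty.transfiniteCompositions.{v} (tensoredTrivialCofibrations V).pushouts ≤
      weakEquivalences V

variable {V} [MonoidalClosed V]

/-- A `V`-category is fibrant if its hom-objects are fibrant. -/
def IsFibrantEnriched (V : Type u) [Category.{v} V] [MonoidalCategory V] [ModelCategory V]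
    (K : Type u₁) [EnrichedCategory V K] : Prop :=
  ∀ X Y : K, IsFibrant (vhom V X Y)

/-- The trivial fibrations of the projective model structure on `[A, V]`. -/
def IsProjTrivialFibration {A : Type v} [EnrichedCategory V A] {E B : EnrichedFunctor V A V}
    (p : VNatTrans E B) : Prop :=
  ∀ a : A, Fibration (p.app a) ∧ WeakEquivalence (p.app a)

/-- `G` is cofibrant in the projective model structure on `[A, V]`: it has the left lifting
property with respect to all trivial fibrations. -/
def IsCofibrantWeight {A : Type v} [EnrichedCategory V A] (G : EnrichedFunctor V A V) : Prop :=
  ∀ (E B : EnrichedFunctor V A V) (p : VNatTrans E B), IsProjTrivialFibration p →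
    ∀ u : VNatTrans G B, ∃ l : VNatTrans G E, ∀ a : A, l.app a ≫ p.app a = u.app a

section HomotopyColimits

variable [HasLimits V] {D : Type v} [EnrichedCategory V D] {K : Type u₁} [EnrichedCategory V K]

/-- `β : K(C, -) ⟶ [Dᵒᵖ, V](G, K(S, -))` exhibits `C` as the homotopy colimit of `S` weighted
by `G`. -/
def IsHomotopyColimit {G : EnrichedFunctor V Dᵒᵖ V} {S : EnrichedFunctor V D K} {C : K}
    (β : VNatTrans (corep C) (weightedCocones G S)) : Prop :=
  ∀ X : K, WeakEquivalence (β.app X)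

/-- `β : K(-, L) ⟶ [D, V](G, K(-, S))` exhibits `L` as the homotopy limit of `S` weighted
by `G`. -/
def IsHomotopyLimit {G : EnrichedFunctor V D V} {S : EnrichedFunctor V D K} {L : K}
    (β : VNatTrans (corep (op L)) (weightedCones G S)) : Prop :=
  ∀ X : Kᵒᵖ, WeakEquivalence (β.app X)

variable (V) (K)

/-- `K` has homotopy colimits of all small diagrams, weighted by cofibrant weights. -/
def HasWeightedHomotopyColimits : Prop :=
  ∀ (D : Type v) [EnrichedCategory V D] (G : EnrichedFunctor V Dᵒᵖ V)
    (S : EnrichedFunctor V D K), IsCofibrantWeight G →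
      ∃ (C : K) (β : VNatTrans (corep C) (weightedCocones G S)), IsHomotopyColimit β

/-- `K` has homotopy limits of all small diagrams, weighted by cofibrant weights. -/
def HasWeightedHomotopyLimits : Prop :=
  ∀ (D : Type v) [EnrichedCategory V D] (G : EnrichedFunctor V D V)
    (S : EnrichedFunctor V D K), IsCofibrantWeight G →
      ∃ (L : K) (β : VNatTrans (corep (op L)) (weightedCones G S)), IsHomotopyLimit β

end HomotopyColimits

/-- A copower `X · A` in a `V`-category: the map `M(X · A, B) ⟶ [X, M(A, B)]` induced by the unit
`X ⟶ M(A, X · A)` is invertible for all `B`. -/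
structure Copower {M : Type u₂} [EnrichedCategory V M] (X : V) (A : M) where
  /-- the copower object -/
  pt : M
  /-- the unit -/
  unit : X ⟶ vhom V A pt
  isIso (B : M) : IsIso (ecurry (unit ▷ vhom V pt B ≫ eComp V A pt B))

namespace Copower

variable {M : Type u₂} [Category.{v₂} M] [EnrichedOrdinaryCategory V M]

/-- The morphism `X · A ⟶ B` corresponding to `X ⟶ M(A, B)`. -/
def desc {X : V} {A : M} (T : Copower X A) {B : M} (g : X ⟶ vhom V A B) : T.pt ⟶ B :=
  have := T.isIso B
  (eHomEquiv V).symm (eHomEquiv V g ≫ inv (ecurry (T.unit ▷ vhom V T.pt B ≫ eComp V A T.pt B)))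

theorem unit_desc {X : V} {A : M} (T : Copower X A) {B : M} (g : X ⟶ vhom V A B) :
    T.unit ≫ eHomWhiskerLeft V A (T.desc g) = g := by
  have := T.isIso B
  have h : eHomEquiv V (T.desc g) ≫ ecurry (T.unit ▷ vhom V T.pt B ≫ eComp V A T.pt B) =
      eHomEquiv V g := by
    simp [desc]
  have h' : eHomEquiv V g = ecurry ((ρ_ X).hom ≫ g) := rfl
  rw [h', comp_ecurry] at h
  have h₂ := ecurry_injective h
  rw [whisker_exchange_assoc] at h₂
  rw [eHomWhiskerLeft, rightUnitor_inv_naturality_assoc, h₂, Iso.inv_hom_id_assoc]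

/-- The morphism `j · A : X · A ⟶ Y · A`. -/
def mapLeft {X Y : V} {A : M} (T : Copower X A) (T' : Copower Y A) (j : X ⟶ Y) : T.pt ⟶ T'.pt :=
  T.desc (j ≫ T'.unit)

/-- The morphism `X · f : X · A ⟶ X · B`. -/
def mapRight {X : V} {A B : M} (T : Copower X A) (T' : Copower X B) (f : A ⟶ B) : T.pt ⟶ T'.pt :=
  T.desc (T'.unit ≫ eHomWhiskerRight V f T'.pt)

end Copower

/-- A model `V`-category: a `V`-category `M` with all small weighted limits and colimits and a
model structure on its underlying category, such that the pushout-product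
`j □ f : Y · A ⨿_{X · A} X · B ⟶ Y · B` of cofibrations `j : X ⟶ Y` in `V` and `f : A ⟶ B` in `M`
is a cofibration, which is trivial if `j` or `f` is. -/
class ModelEnrichedCategory (V : Type u) [Category.{v} V] [MonoidalCategory V]
    [SymmetricCategory V] [ModelCategory V] [MonoidalClosed V] [HasLimits V]
    (M : Type u₂) [Category.{v₂} M] [EnrichedOrdinaryCategory V M] [ModelCategory M] : Prop where
  exists_weightedColimit (D : Type v) [EnrichedCategory V D] (G : EnrichedFunctor V Dᵒᵖ V)
    (S : EnrichedFunctor V D M) :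
    ∃ (C : M) (β : VNatTrans (corep C) (weightedCocones G S)), IsWeightedColimit β
  exists_weightedLimit (D : Type v) [EnrichedCategory V D] (G : EnrichedFunctor V D V)
    (S : EnrichedFunctor V D M) :
    ∃ (L : M) (β : VNatTrans (corep (op L)) (weightedCones G S)), IsWeightedLimit β
  cofibration_pushoutProduct {X Y : V} (j : X ⟶ Y) {A B : M} (f : A ⟶ B) [Cofibration j]
    [Cofibration f] (XA : Copower X A) (YA : Copower Y A) (XB : Copower X B) (YB : Copower Y B)
    {P : M} (inl : YA.pt ⟶ P) (inr : XB.pt ⟶ P)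
    (sq : IsPushout (XA.mapLeft YA j) (XA.mapRight XB f) inl inr) (p : P ⟶ YB.pt)
    (hl : inl ≫ p = YA.mapRight YB f) (hr : inr ≫ p = XB.mapLeft YB j) : Cofibration p
  weakEquivalence_pushoutProduct {X Y : V} (j : X ⟶ Y) {A B : M} (f : A ⟶ B) [Cofibration j]
    [Cofibration f] (XA : Copower X A) (YA : Copower Y A) (XB : Copower X B) (YB : Copower Y B)
    {P : M} (inl : YA.pt ⟶ P) (inr : XB.pt ⟶ P)
    (sq : IsPushout (XA.mapLeft YA j) (XA.mapRight XB f) inl inr) (p : P ⟶ YB.pt)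
    (hl : inl ≫ p = YA.mapRight YB f) (hr : inr ≫ p = XB.mapLeft YB j)
    (h : WeakEquivalence j ∨ WeakEquivalence f) : WeakEquivalence p

section Bifibrant

variable {M : Type u₂} [Category.{v₂} M] [EnrichedOrdinaryCategory V M] [ModelCategory M]

/-- The full sub-`V`-category of `M` on the objects that are both fibrant and cofibrant. -/
instance enrichedCategoryBifibrantObject : EnrichedCategory V (BifibrantObject M) where
  Hom X Y := vhom V X.obj Y.obj
  id X := eId V X.obj
  comp X Y Z := eComp V X.obj Y.obj Z.obj
  id_comp X Y := e_id_comp V X.obj Y.obj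
  comp_id X Y := e_comp_id V X.obj Y.obj
  assoc W X Y Z := e_assoc V W.obj X.obj Y.obj Z.obj

/-- A diagram of bifibrant objects, regarded as a diagram in `M`. -/
def toAmbient {D : Type u₁} [EnrichedCategory V D] (S : EnrichedFunctor V D (BifibrantObject M)) :
    EnrichedFunctor V D M where
  obj d := (S.obj d).obj
  map d e := S.map d e
  map_id d := S.map_id d
  map_comp d e f := S.map_comp d e f

end Bifibrant

end Model

end
end EnrichedHomotopy

open EnrichedHomotopy

namespace EnrichedHomotopy

noncomputable section

/-! ### Hom-objects and morphisms of the underlying category -/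

section EnrichedOrdinary

variable {V : Type u} [Category.{v} V] [MonoidalCategory V] {K : Type u₁} [Category.{v₂} K]
  [EnrichedOrdinaryCategory V K]

/-! Two facts about hom-objects carry the proof. Transposing through copowers turns the
pushout-product axiom for `M` into a lifting property of pullback-homs (`exists_lift_pullbackHom`).
Taking one of the two maps in `M` to be `∅ ⟶ A` or `E ⟶ ⊤` gives: `M(A, p)` is a trivial fibration
for `A` cofibrant and `p` a trivial fibration; `M(f, E)` is one for `f` a trivial cofibration and
`E` fibrant; and `M(A, E)` is fibrant for `A` cofibrant and `E` fibrant.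

Next, `G * S` is cofibrant when the `S d` are. Lifting a map `G * S ⟶ Y` through a trivial fibration
`p : X ⟶ Y` amounts to lifting `G ⟶ M(S, Y)` through `M(S, p)`. The latter is pointwise a trivial
fibration, so cofibrancy of the weight gives the lift. Dually `{G, S}` is fibrant when the `S d`
are. Both cases are instances of `exists_lift_of_isCofibrantWeight`, stated for an arbitrary
`V`-functor `H` into `[A, V]` and applied to `M(S, -)` on `M` and to `M(-, S)` on `Mᵒᵖ`.

Hence a fibrant replacement `r : G * S ⟶ R` by a trivial cofibration has bifibrant target, and `M(r,
A)` is a trivial fibration for `A` fibrant. Composed with the isomorphism defining `G * S`, it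
remains a weak equivalence. Limits are dual, with a cofibrant replacement. -/

theorem eHomEquiv_comp_eHomWhiskerLeft {X Y Z : K} (f : X ⟶ Y) (g : Y ⟶ Z) :
    eHomEquiv V f ≫ eHomWhiskerLeft V X g = eHomEquiv V (f ≫ g) := by
  rw [eHomEquiv_comp, eHomWhiskerLeft, rightUnitor_inv_naturality_assoc,
    MonoidalCategory.tensorHom_def_assoc, unitors_inv_equal]

theorem eHomEquiv_comp_eHomWhiskerRight {X Y Z : K} (f : X ⟶ Y) (g : Y ⟶ Z) :
    eHomEquiv V g ≫ eHomWhiskerRight V f Z = eHomEquiv V (f ≫ g) := by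
  rw [eHomEquiv_comp, eHomWhiskerRight, leftUnitor_inv_naturality_assoc,
    MonoidalCategory.tensorHom_def'_assoc]

theorem tensor_eHomEquiv_eComp {X Y Z : K} {P : V} (f : P ⟶ vhom V X Y) (g : Y ⟶ Z) :
    (f ⊗ₘ eHomEquiv V g) ≫ eComp V X Y Z = (ρ_ P).hom ≫ f ≫ eHomWhiskerLeft V X g := by
  rw [eHomWhiskerLeft, rightUnitor_inv_naturality_assoc, Iso.hom_inv_id_assoc,
    MonoidalCategory.tensorHom_def_assoc]

theorem eHomEquiv_tensor_eComp {X Y Z : K} {P : V} (g : X ⟶ Y) (f : P ⟶ vhom V Y Z) :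
    (eHomEquiv V g ⊗ₘ f) ≫ eComp V X Y Z = (λ_ P).hom ≫ f ≫ eHomWhiskerRight V g Z := by
  rw [eHomWhiskerRight, leftUnitor_inv_naturality_assoc, Iso.hom_inv_id_assoc,
    MonoidalCategory.tensorHom_def'_assoc]

/-- The symmetry built into composition in `Kᵒᵖ` is here a braiding with the unit object, which
unitor coherence removes. This and the next lemma translate the limit half of the argument from
`Mᵒᵖ` back to `M`. -/
theorem eHomWhiskerLeft_op [SymmetricCategory V] {X Y : K} (Z : K) (f : X ⟶ Y) :
    eHomWhiskerLeft V (op Z) f.op = eHomWhiskerRight V f Z := by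
  change (ρ_ _).inv ≫ _ ◁ eHomEquiv V f ≫ (β_ _ _).hom ≫ eComp V X Y Z = _
  rw [BraidedCategory.braiding_naturality_right_assoc, rightUnitor_inv_braiding_assoc]
  rfl

theorem eHomWhiskerRight_op [SymmetricCategory V] {X Y : K} (Z : K) (f : X ⟶ Y) :
    eHomWhiskerRight V f.op (op Z) = eHomWhiskerLeft V Z f := by
  change (λ_ _).inv ≫ eHomEquiv V f ▷ _ ≫ (β_ _ _).hom ≫ eComp V Z X Y = _
  rw [BraidedCategory.braiding_naturality_left_assoc, leftUnitor_inv_braiding_assoc]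
  rfl

end EnrichedOrdinary

/-! ### `V`-natural transformations between `V`-valued functors, and the Yoneda lemma -/

section Closed

variable {V : Type u} [Category.{v} V] [MonoidalCategory V] [MonoidalClosed V]

theorem ecurry_eHomWhiskerLeft {A B C Y : V} (f : A ⊗ Y ⟶ B) (g : B ⟶ C) :
    ecurry f ≫ eHomWhiskerLeft V A g = ecurry (f ≫ g) := by
  rw [MonoidalClosed.enrichedOrdinaryCategorySelf_eHomWhiskerLeft]
  exact (MonoidalClosed.curry_natural_right f g).symm

theorem eHomEquiv_self {A B : V} (f : A ⟶ B) : eHomEquiv V f = ecurry ((ρ_ A).hom ≫ f) := rfl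

theorem ecurry_eHomWhiskerRight {A B C Y : V} (f : B ⊗ Y ⟶ C) (g : A ⟶ B) :
    ecurry f ≫ eHomWhiskerRight V g C = ecurry (g ▷ Y ≫ f) := by
  rw [eHomWhiskerRight, leftUnitor_inv_naturality_assoc, ← MonoidalCategory.tensorHom_def'_assoc,
    eHomEquiv_self, ecurry_eComp, comp_ecurry]
  congr 1
  simp

namespace VNatTrans

section

variable {A : Type u₁} [EnrichedCategory V A] {F G H : EnrichedFunctor V A V}

/-- Composition of `V`-natural transformations. -/
def comp (s : VNatTrans F G) (t : VNatTrans G H) : VNatTrans F H where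
  app a := s.app a ≫ t.app a
  naturality a b := by
    rw [eHomWhiskerLeft_comp, ← Category.assoc, s.naturality, Category.assoc,
      ← eHom_whisker_exchange, ← Category.assoc, t.naturality, Category.assoc,
      ← eHomWhiskerRight_comp]

end

variable {K : Type u₁} [Category.{v₂} K] [EnrichedOrdinaryCategory V K]

/-- The action of a `V`-functor to `V` on a morphism of the underlying category. -/
def mapHom (F : EnrichedFunctor V K V) {X Y : K} (f : X ⟶ Y) : F.obj X ⟶ F.obj Y :=
  (eHomEquiv V).symm (eHomEquiv V f ≫ F.map X Y)

theorem eHomEquiv_mapHom (F : EnrichedFunctor V K V) {X Y : K} (f : X ⟶ Y) :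
    eHomEquiv V (mapHom F f) = eHomEquiv V f ≫ F.map X Y :=
  Equiv.apply_symm_apply _ _

/-- Enriched naturality is an equation of maps out of `K(X, Y)`; precomposing it with the element of
`K(X, Y)` named by `f` leaves the ordinary naturality square. -/
theorem mapHom_app {F G : EnrichedFunctor V K V} (t : VNatTrans F G) {X Y : K} (f : X ⟶ Y) :
    mapHom F f ≫ t.app Y = t.app X ≫ mapHom G f := by
  apply (eHomEquiv V).injective
  rw [← eHomEquiv_comp_eHomWhiskerLeft, ← eHomEquiv_comp_eHomWhiskerRight, eHomEquiv_mapHom,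
    eHomEquiv_mapHom, Category.assoc, Category.assoc, t.naturality]

theorem mapHom_corep (C : K) {X Y : K} (f : X ⟶ Y) :
    mapHom (corep (V := V) C) f = eHomWhiskerLeft V C f := by
  apply (eHomEquiv V).injective
  rw [eHomEquiv_mapHom, comp_ecurry, eHomEquiv_self, eHomWhiskerLeft, Iso.hom_inv_id_assoc]

theorem eHomEquiv_comp_ecurry_eComp (C : K) {X Y : K} (p : X ⟶ Y) :
    eHomEquiv V p ≫ ecurry (eComp V C X Y) = eHomEquiv V (eHomWhiskerLeft V C p) := by
  rw [← mapHom_corep]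
  exact (eHomEquiv_mapHom (corep C) p).symm

/-- The `V`-natural transformation `K(Y, -) ⟶ K(X, -)` induced by `X ⟶ Y`. -/
def corepMap {X Y : K} (f : X ⟶ Y) : VNatTrans (corep (V := V) Y) (corep X) where
  app Z := eHomWhiskerRight V f Z
  naturality Z W := by
    rw [ecurry_eHomWhiskerLeft, ecurry_eHomWhiskerRight, eComp_eHomWhiskerRight]

/-- The enriched Yoneda lemma: a `V`-natural transformation out of a representable `V`-functor is
determined by the image of the identity. -/
theorem leftUnitor_hom_app {F : EnrichedFunctor V K V} {C : K} (t : VNatTrans (corep C) F) (B : K)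
    {φ : F.obj C ⊗ vhom V C B ⟶ F.obj B} (hφ : F.map C B = ecurry φ) :
    (λ_ _).hom ≫ t.app B = (eId V C ≫ t.app C) ▷ _ ≫ φ := by
  -- Naturality at `(C, B)`, untransposed, compares two maps out of `K(C, C) ⊗ K(C, B)`; inserting
  -- the identity of `C` in the first factor gives the claim.
  have h := t.naturality C B
  rw [hφ, ecurry_eHomWhiskerLeft, ecurry_eHomWhiskerRight] at h
  rw [comp_whiskerRight, Category.assoc, ← ecurry_injective h, ← Category.assoc]
  congr 1
  have := eId_tensor_eComp (V := V) (𝟙 (vhom V C B))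
  rw [Category.comp_id, tensorHom_id] at this
  exact this.symm

end VNatTrans

end Closed

/-! ### Global elements of `[A, V](F, G)` and lifting against a cofibrant weight -/

section Elements

variable {V : Type u} [Category.{v} V] [MonoidalCategory V] [MonoidalClosed V]
  [SymmetricCategory V] {A : Type v} [EnrichedCategory V A]
  {F G : EnrichedFunctor V A V}

/-- Grading by the unit object is no grading: the braiding and unitors cancel. So elements `𝟙_ V ⟶
[A, V](F, G)` of the end are exactly `V`-natural transformations. -/
theorem isNatFamily_eHomEquiv_iff (σ : ∀ a : A, F.obj a ⟶ G.obj a) :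
    IsNatFamily (F := F) (G := G) (fun a => eHomEquiv V (σ a)) ↔
      ∀ a b : A, F.map a b ≫ eHomWhiskerLeft V (F.obj a) (σ b) =
        G.map a b ≫ eHomWhiskerRight V (σ a) (G.obj b) := by
  refine forall₂_congr fun a b => ?_
  rw [tensor_eHomEquiv_eComp, eHomEquiv_tensor_eComp, braiding_leftUnitor_assoc, cancel_epi]
  exact eq_comm

variable [HasLimits V]

/-- The morphism `𝟙_ V ⟶ [A, V](F, G)` corresponding to a `V`-natural transformation. -/
def VNatTrans.toElement (t : VNatTrans F G) : 𝟙_ V ⟶ natObj F G :=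
  natObjLift (fun a => eHomEquiv V (t.app a)) ((isNatFamily_eHomEquiv_iff _).2 t.naturality)

theorem VNatTrans.toElement_π (t : VNatTrans F G) (a : A) :
    t.toElement ≫ natObjπ F G a = eHomEquiv V (t.app a) :=
  natObjLift_π _ _ a

/-- The `V`-natural transformation corresponding to a morphism `𝟙_ V ⟶ [A, V](F, G)`. -/
def VNatTrans.ofElement (t : 𝟙_ V ⟶ natObj F G) : VNatTrans F G where
  app a := (eHomEquiv V).symm (t ≫ natObjπ F G a)
  naturality := by
    rw [← isNatFamily_eHomEquiv_iff]
    simpa only [Equiv.apply_symm_apply] using isNatFamily_comp_π t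

theorem VNatTrans.eHomEquiv_ofElement_app (t : 𝟙_ V ⟶ natObj F G) (a : A) :
    eHomEquiv V ((VNatTrans.ofElement t).app a) = t ≫ natObjπ F G a :=
  Equiv.apply_symm_apply _ _

theorem tensor_natObjComp_π {E F G : EnrichedFunctor V A V} {P Q : V} (f : P ⟶ natObj E F)
    (g : Q ⟶ natObj F G) (a : A) :
    (f ⊗ₘ g) ≫ natObjComp E F G ≫ natObjπ E G a =
      ((f ≫ natObjπ E F a) ⊗ₘ (g ≫ natObjπ F G a)) ≫
        eComp V (E.obj a) (F.obj a) (G.obj a) := by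
  rw [natObjComp_π, tensorHom_comp_tensorHom_assoc]

variable {K : Type u₁} [Category.{v₂} K] [EnrichedOrdinaryCategory V K]

/-- The `V`-natural transformation `H X ⟶ H Y` induced by `X ⟶ Y`. -/
def functorHom (H : EnrichedFunctor V K (EnrichedFunctor V A V)) {X Y : K} (p : X ⟶ Y) :
    VNatTrans (H.obj X) (H.obj Y) :=
  VNatTrans.ofElement (eHomEquiv V p ≫ H.map X Y)

/-- The projection `[A, V](G, H X) ⟶ [G a, H X a]`. -/
def homProj (H : EnrichedFunctor V K (EnrichedFunctor V A V)) (G : EnrichedFunctor V A V)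
    (X : K) (a : A) :
    (H.comp V (corep G)).obj X ⟶ vhom V (G.obj a) ((H.obj X).obj a) :=
  natObjπ G (H.obj X) a

theorem homProj_hom_ext (H : EnrichedFunctor V K (EnrichedFunctor V A V))
    {G : EnrichedFunctor V A V} {X : K} {T : V} {f g : T ⟶ (H.comp V (corep G)).obj X}
    (h : ∀ a, f ≫ homProj H G X a = g ≫ homProj H G X a) : f = g :=
  natObj_hom_ext h

/-- The transpose of the action of `[A, V](G, H -)` on hom-objects. -/
def homAct (H : EnrichedFunctor V K (EnrichedFunctor V A V)) (G : EnrichedFunctor V A V)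
    (X Y : K) : (H.comp V (corep G)).obj X ⊗ vhom V X Y ⟶ (H.comp V (corep G)).obj Y :=
  (natObj G (H.obj X)) ◁ H.map X Y ≫ natObjComp G (H.obj X) (H.obj Y)

theorem map_eq_ecurry_homAct (H : EnrichedFunctor V K (EnrichedFunctor V A V))
    (G : EnrichedFunctor V A V) (X Y : K) :
    (H.comp V (corep G)).map X Y = ecurry (homAct H G X Y) :=
  comp_ecurry (H.map X Y) (natObjComp G (H.obj X) (H.obj Y))

/-- Composition in `[A, V]` is pointwise, so the action can be computed after projecting to each
`a`. -/
theorem homAct_homProj (H : EnrichedFunctor V K (EnrichedFunctor V A V))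
    (G : EnrichedFunctor V A V) (X Y : K) (a : A) :
    homAct H G X Y ≫ homProj H G Y a =
      (homProj H G X a ⊗ₘ (H.map X Y ≫ natObjπ (H.obj X) (H.obj Y) a)) ≫
        eComp V (G.obj a) ((H.obj X).obj a) ((H.obj Y).obj a) := by
  have h := tensor_natObjComp_π (𝟙 (natObj G (H.obj X))) (H.map X Y) a
  rw [id_tensorHom, Category.id_comp] at h
  exact (Category.assoc _ _ _).trans h

/-- The components of a `V`-natural transformation `K(C, -) ⟶ [A, V](G, H -)` are determined by
the image of the identity. -/
theorem leftUnitor_hom_app_homProj (H : EnrichedFunctor V K (EnrichedFunctor V A V))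
    {G : EnrichedFunctor V A V} {C : K} (t : VNatTrans (corep C) (H.comp V (corep G)))
    (B : K) (a : A) :
    (λ_ (vhom V C B)).hom ≫ t.app B ≫ homProj H G B a =
      ((eId V C ≫ t.app C ≫ homProj H G C a) ⊗ₘ (H.map C B ≫ natObjπ (H.obj C) (H.obj B) a)) ≫
        eComp V (G.obj a) ((H.obj C).obj a) ((H.obj B).obj a) := by
  have h : (λ_ (vhom V C B)).hom ≫ t.app B = (eId V C ≫ t.app C) ▷ vhom V C B ≫ homAct H G C B :=
    t.leftUnitor_hom_app B (map_eq_ecurry_homAct H G C B)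
  rw [← Category.assoc, h, Category.assoc, homAct_homProj, whiskerRight_comp_tensorHom_assoc,
    Category.assoc]

/-- On underlying morphisms, `[A, V](G, H p)` is pointwise postcomposition with `H p`; this matches
lifts through `H p` with lifts through `p`. -/
theorem mapHom_homProj (H : EnrichedFunctor V K (EnrichedFunctor V A V))
    (G : EnrichedFunctor V A V) {X Y : K} (p : X ⟶ Y) (a : A) :
    VNatTrans.mapHom (H.comp V (corep G)) p ≫ homProj H G Y a =
      homProj H G X a ≫ eHomWhiskerLeft V (G.obj a) ((functorHom H p).app a) := by
  apply (eHomEquiv V).injective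
  have h := VNatTrans.eHomEquiv_ofElement_app (eHomEquiv V p ≫ H.map X Y) a
  rw [Category.assoc] at h
  rw [← eHomEquiv_comp_eHomWhiskerLeft, VNatTrans.eHomEquiv_mapHom, map_eq_ecurry_homAct,
    comp_ecurry, ecurry_eHomWhiskerLeft, eHomEquiv_self, Category.assoc, homAct_homProj,
    whiskerLeft_comp_tensorHom_assoc, ← h, tensor_eHomEquiv_eComp]
  rfl

/-- If `C` represents `[A, V](G, H -)` for a cofibrant weight `G`, then it has the left lifting
property with respect to the morphisms sent by `H` to projective trivial fibrations. -/
theorem exists_lift_of_isCofibrantWeight [ModelCategory V]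
    (H : EnrichedFunctor V K (EnrichedFunctor V A V)) {G : EnrichedFunctor V A V}
    (hG : IsCofibrantWeight G) {C : K} (t : VNatTrans (corep C) (H.comp V (corep G)))
    (ht : ∀ X, IsIso (t.app X)) {X Y : K} (p : X ⟶ Y)
    (hp : IsProjTrivialFibration (functorHom H p)) (c : C ⟶ Y) : ∃ l : C ⟶ X, l ≫ p = c := by
  obtain ⟨(i : (H.comp V (corep G)).obj X ⟶ vhom V C X), -, hi⟩ := (ht X).out
  -- The morphism `c`, seen as an element of `K(C, Y)`, is sent by `t` to a transformation `G ⟶ H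
  -- Y`, which cofibrancy lifts to `G ⟶ H X`. The inverse `i` of `t.app X` then carries the lift
  -- back to a morphism `C ⟶ X`.
  obtain ⟨l, hl⟩ := hG _ _ (functorHom H p) hp
    (VNatTrans.ofElement (eHomEquiv V c ≫ t.app Y))
  obtain ⟨e, he⟩ : ∃ e : 𝟙_ V ⟶ (H.comp V (corep G)).obj X,
      ∀ a, e ≫ homProj H G X a = eHomEquiv V (l.app a) := ⟨l.toElement, l.toElement_π⟩
  have hi' : i ≫ t.app X = 𝟙 _ := hi
  refine ⟨(eHomEquiv V).symm (e ≫ i), ?_⟩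
  apply (eHomEquiv V).injective
  have key : eHomWhiskerLeft V C p ≫ t.app Y =
      t.app X ≫ VNatTrans.mapHom (H.comp V (corep G)) p := by
    rw [← VNatTrans.mapHom_corep]
    exact t.mapHom_app p
  rw [← eHomEquiv_comp_eHomWhiskerLeft, Equiv.apply_symm_apply]
  have : Mono (t.app Y) := @IsIso.mono_of_iso _ _ _ _ _ (ht Y)
  -- Since `t.app Y` is invertible, the equation may be tested in `[A, V](G, H Y)`, hence
  -- componentwise.
  apply (cancel_mono (t.app Y)).1
  rw [Category.assoc, key, Category.assoc, reassoc_of% hi']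
  apply homProj_hom_ext
  intro a
  have h : _ = (eHomEquiv V c ≫ t.app Y) ≫ homProj H G Y a :=
    VNatTrans.eHomEquiv_ofElement_app (F := G) (G := H.obj Y) (eHomEquiv V c ≫ t.app Y) a
  rw [Category.assoc, mapHom_homProj, ← Category.assoc, he, eHomEquiv_comp_eHomWhiskerLeft, hl, h]

end Elements

end

end EnrichedHomotopy

namespace EnrichedHomotopy

noncomputable section

/-! ### Colimits over the unit and empty `V`-categories: copowers and an initial object -/

section Unit

variable {V : Type u} [Category.{v} V] [MonoidalCategory V]

/-- The unit `V`-category, with one object whose hom-object is the unit. -/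
@[reducible]
def unitEnrichedCategory : EnrichedCategory V PUnit.{v + 1} where
  Hom _ _ := 𝟙_ V
  id _ := 𝟙 _
  comp _ _ _ := (λ_ _).hom
  id_comp _ _ := by simp
  comp_id _ _ := by simp [unitors_equal]
  assoc _ _ _ _ := by simp [unitors_equal]

/-- The empty `V`-category. -/
@[reducible]
def emptyEnrichedCategory : EnrichedCategory V PEmpty.{v + 1} where
  Hom a _ := a.elim
  id a := a.elim
  comp a _ _ := a.elim
  id_comp a _ := a.elim
  comp_id a _ := a.elim
  assoc a _ _ _ := a.elim

attribute [local instance] unitEnrichedCategory emptyEnrichedCategory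

/-- The `V`-functor on the unit `V`-category picking out an object. -/
def constFunctor {K : Type u₁} [EnrichedCategory V K] (X : K) :
    EnrichedFunctor V PUnit.{v + 1} K where
  obj _ := X
  map _ _ := eId V X
  map_id _ := Category.id_comp _
  map_comp _ _ _ := (eId_tensor_eComp (eId V X)).symm

/-- The `V`-functor on the opposite of the unit `V`-category picking out an object. -/
def constFunctorOp [SymmetricCategory V] {K : Type u₁} [EnrichedCategory V K] (X : K) :
    EnrichedFunctor V PUnit.{v + 1}ᵒᵖ K where
  obj _ := X
  map _ _ := eId V X
  map_id _ := Category.id_comp _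
  map_comp _ _ _ := by
    rw [eId_tensor_eComp]
    change ((β_ (𝟙_ V) (𝟙_ V)).hom ≫ (λ_ (𝟙_ V)).hom) ≫ _ = (λ_ (𝟙_ V)).hom ≫ _
    rw [braiding_leftUnitor, unitors_equal]

/-- The `V`-functor out of the empty `V`-category. -/
def emptyFunctor {K : Type u₁} [EnrichedCategory V K] :
    EnrichedFunctor V PEmpty.{v + 1} K where
  obj a := a.elim
  map a := a.elim
  map_id a := a.elim
  map_comp a := a.elim

/-- The `V`-functor out of the opposite of the empty `V`-category. -/
def emptyFunctorOp [SymmetricCategory V] {K : Type u₁} [EnrichedCategory V K] :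
    EnrichedFunctor V PEmpty.{v + 1}ᵒᵖ K where
  obj a := a.unop.elim
  map a := a.unop.elim
  map_id a := a.unop.elim
  map_comp a := a.unop.elim

variable [MonoidalClosed V] [SymmetricCategory V] [HasLimits V]

/-- The only hom-object is the unit, so preservation of identities determines the action of `F` and
`G` and naturality holds automatically: the end is a single internal hom. -/
theorem isIso_natObjπ_of_unit (F G : EnrichedFunctor V PUnit.{v + 1}ᵒᵖ V) :
    IsIso (natObjπ F G (op PUnit.unit)) := by
  let a : PUnit.{v + 1}ᵒᵖ := op PUnit.unit
  have map_eq (H : EnrichedFunctor V PUnit.{v + 1}ᵒᵖ V) : H.map a a = eId V (H.obj a) :=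
    (Category.id_comp _).symm.trans (H.map_id a)
  let σ : ∀ b, vhom V (F.obj a) (G.obj a) ⟶ vhom V (F.obj b) (G.obj b)
    | ⟨PUnit.unit⟩ => 𝟙 _
  have nat : IsNatFamily (F := F) (G := G) σ := by
    rintro ⟨⟨⟩⟩ ⟨⟨⟩⟩
    change (β_ (𝟙_ V) _).hom ≫ (σ a ⊗ₘ G.map a a) ≫ eComp V (F.obj a) (G.obj a) (G.obj a) =
      (F.map a a ⊗ₘ σ a) ≫ eComp V (F.obj a) (F.obj a) (G.obj a)
    rw [map_eq, map_eq, tensor_eId_eComp, eId_tensor_eComp]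
    exact (braiding_rightUnitor_assoc (C := V) _ _)
  refine ⟨natObjLift _ nat, natObj_hom_ext ?_, natObjLift_π _ nat a⟩
  rintro ⟨⟨⟩⟩
  rw [Category.assoc, natObjLift_π, Category.id_comp]
  exact Category.comp_id _

variable {M : Type u₂} [Category.{v₂} M] [EnrichedOrdinaryCategory V M]

theorem presheafFunctor_map_π {D : Type v} [EnrichedCategory V D] (S : EnrichedFunctor V D M)
    (X Y : M) (d : Dᵒᵖ) :
    (presheafFunctor S).map X Y ≫ natObjπ _ _ d = ecurry (eComp V (S.obj d.unop) X Y) :=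
  homFromMap_π S X Y d

/-- The weighted colimit of the diagram `A` on the unit `V`-category, weighted by `X`, is the
copower `X · A`. -/
theorem nonempty_copower_of_isWeightedColimit [ModelCategory V] (X : V) (A : M) {C : M}
    (β : VNatTrans (corep C)
      (weightedCocones (constFunctorOp (V := V) X) (constFunctor (V := V) A)))
    (hβ : IsWeightedColimit β) : Nonempty (Copower X A) := by
  let S : EnrichedFunctor V PUnit.{v + 1} M := constFunctor A
  let G : EnrichedFunctor V PUnit.{v + 1}ᵒᵖ V := constFunctorOp X
  let a : PUnit.{v + 1}ᵒᵖ := op PUnit.unit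
  let φ (B : M) : vhom V C B ⟶ vhom V X (vhom V A B) :=
    β.app B ≫ homProj (presheafFunctor S) G B a
  -- As in Yoneda, the unit of the copower is the image of the identity of `C`; `key` then says that
  -- the whole representation is composition with this unit.
  let unit : X ⟶ vhom V A C := (eHomEquiv V).symm (eId V C ≫ φ C)
  have h_unit : eId V C ≫ φ C = ecurry ((ρ_ X).hom ≫ unit) :=
    ((eHomEquiv V).apply_symm_apply _).symm
  refine ⟨⟨C, unit, fun B => ?_⟩⟩
  have key : φ B = ecurry (unit ▷ vhom V C B ≫ eComp V A C B) := by
    have h₁ : (λ_ _).hom ≫ φ B = ((eId V C ≫ φ C) ⊗ₘ ecurry (eComp V A C B)) ≫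
        eComp V X (vhom V A C) (vhom V A B) := by
      have h := leftUnitor_hom_app_homProj (presheafFunctor S) (G := G) β B a
      rw [presheafFunctor_map_π] at h
      exact h
    rw [h_unit, ecurry_eComp] at h₁
    rw [← cancel_epi (λ_ (vhom V C B)).hom, h₁, comp_ecurry]
    congr 1
    simp
  rw [← key]
  have h₁ : IsIso (homProj (presheafFunctor S) G B a) := isIso_natObjπ_of_unit _ _
  have h₂ := hβ B
  exact IsIso.comp_isIso' h₂ h₁

/-- A colimit of the empty diagram is initial in the enriched sense. -/
theorem existsUnique_hom_of_isWeightedColimit_empty {C : M}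
    (β : VNatTrans (corep C)
      (weightedCocones (emptyFunctorOp (V := V)) (emptyFunctor (V := V))))
    (hβ : IsWeightedColimit β) (X : M) (T : V) :
    ∃ f : T ⟶ vhom V C X, ∀ g : T ⟶ vhom V C X, g = f := by
  have h := hβ X
  obtain ⟨i, h₁, -⟩ := h.out
  let S : EnrichedFunctor V PEmpty.{v + 1} M := emptyFunctor
  let G : EnrichedFunctor V PEmpty.{v + 1}ᵒᵖ V := emptyFunctorOp
  -- An end over the empty `V`-category is terminal in `V`, and `M(C, X)` is isomorphic to it.
  refine ⟨natObjLift (F := G) (G := homFrom S X) (fun a => a.unop.elim)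
    (fun a => a.unop.elim) ≫ i, fun g => ?_⟩
  refine (Category.comp_id g).symm.trans ?_
  rw [← h₁, ← Category.assoc]
  congr 1
  exact natObj_hom_ext fun a => a.unop.elim

end Unit

/-! ### Calculus of copowers -/

section Copowers

variable {V : Type u} [Category.{v} V] [MonoidalCategory V] [MonoidalClosed V]
  {M : Type u₂} [Category.{v₂} M] [EnrichedOrdinaryCategory V M]

namespace Copower

/-- On elements, the isomorphism `M(X · A, B) ≅ [X, M(A, B)]` sends `f` to the composite of the unit
with `M(A, f)`. -/
theorem hom_ext {X : V} {A B : M} (T : Copower X A) {f g : T.pt ⟶ B}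
    (h : T.unit ≫ eHomWhiskerLeft V A f = T.unit ≫ eHomWhiskerLeft V A g) : f = g := by
  have := T.isIso B
  have key (f : T.pt ⟶ B) :
      eHomEquiv V f ≫ ecurry (T.unit ▷ vhom V T.pt B ≫ eComp V A T.pt B) =
        ecurry ((ρ_ X).hom ≫ T.unit ≫ eHomWhiskerLeft V A f) := by
    rw [comp_ecurry, whisker_exchange_assoc, eHomWhiskerLeft, rightUnitor_inv_naturality_assoc,
      Iso.hom_inv_id_assoc]
  apply (eHomEquiv V).injective
  rw [← cancel_mono (ecurry (T.unit ▷ vhom V T.pt B ≫ eComp V A T.pt B)), key, key, h]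

variable [SymmetricCategory V] [ModelCategory V]

theorem desc_comp {X : V} {A B B' : M} (T : Copower X A) (g : X ⟶ vhom V A B) (p : B ⟶ B') :
    T.desc g ≫ p = T.desc (g ≫ eHomWhiskerLeft V A p) :=
  T.hom_ext (by rw [eHomWhiskerLeft_comp, ← Category.assoc, unit_desc, unit_desc])

theorem mapLeft_desc {X Y : V} {A B : M} (T : Copower X A) (T' : Copower Y A) (j : X ⟶ Y)
    (g : Y ⟶ vhom V A B) : T.mapLeft T' j ≫ T'.desc g = T.desc (j ≫ g) := by
  rw [mapLeft, desc_comp, Category.assoc, unit_desc]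

theorem mapRight_desc {X : V} {A A' B : M} (T : Copower X A) (T' : Copower X A') (f : A ⟶ A')
    (g : X ⟶ vhom V A' B) : T.mapRight T' f ≫ T'.desc g = T.desc (g ≫ eHomWhiskerRight V f B) := by
  rw [mapRight, desc_comp, Category.assoc, ← eHom_whisker_exchange, ← Category.assoc, unit_desc]

end Copower

end Copowers

/-! ### Pushout-products and lifting properties of hom-objects -/

section ModelLifting

theorem fibration_of_hasLiftingProperty {C : Type u} [Category.{v} C] [ModelCategory C] {X Y : C}
    (p : X ⟶ Y)
    (h : ∀ {A B : C} (j : A ⟶ B) [Cofibration j] [WeakEquivalence j], HasLiftingProperty j p) :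
    Fibration p := by
  rw [fibration_iff, ← trivialCofibrations_rlp]
  intro A B j hj
  obtain ⟨_, _⟩ := (mem_trivialCofibrations_iff j).1 hj
  exact h j

theorem trivialFibration_of_hasLiftingProperty {C : Type u} [Category.{v} C] [ModelCategory C]
    {X Y : C} (p : X ⟶ Y)
    (h : ∀ {A B : C} (j : A ⟶ B) [Cofibration j], HasLiftingProperty j p) :
    Fibration p ∧ WeakEquivalence p := by
  rw [← mem_trivialFibrations_iff, ← cofibrations_rlp]
  intro A B j hj
  have := (cofibration_iff j).2 hj
  exact h j

variable {V : Type u} [Category.{v} V] [MonoidalCategory V] [SymmetricCategory V]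
  [MonoidalClosed V] [HasLimits V] [ModelCategory V]
  {M : Type u₂} [Category.{v₂} M] [EnrichedOrdinaryCategory V M] [ModelCategory M]
  [ModelEnrichedCategory V M]

theorem nonempty_copower (X : V) (A : M) : Nonempty (Copower X A) := by
  let _ : EnrichedCategory V PUnit.{v + 1} := unitEnrichedCategory
  obtain ⟨C, β, hβ⟩ := ModelEnrichedCategory.exists_weightedColimit (V := V) (M := M)
    PUnit.{v + 1} (constFunctorOp X) (constFunctor A)
  exact nonempty_copower_of_isWeightedColimit X A β hβ

variable (V M) in
-- Initiality in the underlying category controls only elements `𝟙_ V ⟶ M(C, X)`. The lifting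
-- argument needs `M(C, X)` terminal in `V`, which the empty weighted colimit supplies.
theorem exists_enrichedInitial :
    ∃ C : M, ∀ (X : M) (T : V), ∃ f : T ⟶ vhom V C X, ∀ g : T ⟶ vhom V C X, g = f := by
  let _ : EnrichedCategory V PEmpty.{v + 1} := emptyEnrichedCategory
  obtain ⟨C, β, hβ⟩ := ModelEnrichedCategory.exists_weightedColimit (V := V) (M := M)
    PEmpty.{v + 1} emptyFunctorOp emptyFunctor
  exact ⟨C, existsUnique_hom_of_isWeightedColimit_empty β hβ⟩

/-- Maps `T ⟶ M(A, Z)` correspond to maps `T · A ⟶ Z`, so ordinary terminality of `Z` is enough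
here. -/
theorem hom_terminal_ext {T : V} {A Z : M} (hZ : IsTerminal Z) (f g : T ⟶ vhom V A Z) : f = g := by
  obtain ⟨P⟩ := nonempty_copower T A
  rw [← P.unit_desc f, ← P.unit_desc g, hZ.hom_ext (P.desc f) (P.desc g)]

/-- The lifting property of `j` against the pullback-hom of `f` and `p`, for cofibrations `j` and
`f` and a fibration `p`, one of which is a weak equivalence. -/
theorem exists_lift_pullbackHom {X Y : V} (j : X ⟶ Y) {A B E E' : M} (f : A ⟶ B) (p : E ⟶ E')
    [Cofibration j] [Cofibration f] [Fibration p]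
    (h : (WeakEquivalence j ∨ WeakEquivalence f) ∨ WeakEquivalence p)
    (a : X ⟶ vhom V B E) (b : Y ⟶ vhom V A E) (c : Y ⟶ vhom V B E')
    (hab : a ≫ eHomWhiskerRight V f E = j ≫ b) (hac : a ≫ eHomWhiskerLeft V B p = j ≫ c)
    (hbc : b ≫ eHomWhiskerLeft V A p = c ≫ eHomWhiskerRight V f E') :
    ∃ l : Y ⟶ vhom V B E, j ≫ l = a ∧ l ≫ eHomWhiskerRight V f E = b ∧
      l ≫ eHomWhiskerLeft V B p = c := by
  obtain ⟨XA⟩ := nonempty_copower X A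
  obtain ⟨YA⟩ := nonempty_copower Y A
  obtain ⟨XB⟩ := nonempty_copower X B
  obtain ⟨YB⟩ := nonempty_copower Y B
  have sq := IsPushout.of_hasPushout (XA.mapLeft YA j) (XA.mapRight XB f)
  have comm : XA.mapLeft YA j ≫ YA.mapRight YB f = XA.mapRight XB f ≫ XB.mapLeft YB j := by
    rw [Copower.mapRight, Copower.mapLeft_desc, Copower.mapLeft.eq_1 XB, Copower.mapRight_desc,
      Category.assoc]
  let i := sq.desc (YA.mapRight YB f) (XB.mapLeft YB j) comm
  have hl : pushout.inl _ _ ≫ i = YA.mapRight YB f := sq.inl_desc _ _ _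
  have hr : pushout.inr _ _ ≫ i = XB.mapLeft YB j := sq.inr_desc _ _ _
  have : Cofibration i :=
    ModelEnrichedCategory.cofibration_pushoutProduct j f XA YA XB YB _ _ sq i hl hr
  have lift : HasLiftingProperty i p := by
    rcases h with h | h
    · have : WeakEquivalence i :=
        ModelEnrichedCategory.weakEquivalence_pushoutProduct j f XA YA XB YB _ _ sq i hl hr h
      infer_instance
    · infer_instance
  -- The data `a`, `b`, `c` transpose to a square from the pushout-product `i` to `p`: `hab` glues
  -- the top map over the pushout, while `hbc` and `hac` give commutativity on its two legs.
  let t := sq.desc (YA.desc b) (XB.desc a) (by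
    rw [Copower.mapLeft_desc, Copower.mapRight_desc, hab])
  have ht₁ : pushout.inl _ _ ≫ t = YA.desc b := sq.inl_desc _ _ _
  have ht₂ : pushout.inr _ _ ≫ t = XB.desc a := sq.inr_desc _ _ _
  have csq : CommSq t i p (YB.desc c) := ⟨by
    apply sq.hom_ext
    · rw [reassoc_of% ht₁, reassoc_of% hl, Copower.desc_comp, Copower.mapRight_desc, hbc]
    · rw [reassoc_of% ht₂, reassoc_of% hr, Copower.desc_comp, Copower.mapLeft_desc, hac]⟩
  have fac₁ := csq.fac_left
  have fac₂ := csq.fac_right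
  -- The required map is the transpose of the diagonal filler; each of its equations is checked
  -- after transposing back to a copower.
  let l := YB.unit ≫ eHomWhiskerLeft V B csq.lift
  have hdesc : YB.desc l = csq.lift := YB.hom_ext (YB.unit_desc l)
  refine ⟨l, ?_, ?_, ?_⟩
  · rw [← XB.unit_desc (j ≫ l), ← XB.mapLeft_desc YB, hdesc, ← hr, Category.assoc, fac₁, ht₂,
      XB.unit_desc]
  · rw [← YA.unit_desc (l ≫ _), ← YA.mapRight_desc YB, hdesc, ← hl, Category.assoc, fac₁, ht₁,
      YA.unit_desc]
  · rw [← YB.unit_desc (l ≫ _), ← YB.desc_comp, hdesc, fac₂, YB.unit_desc]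

/-- This is the pullback-hom lifting property for `∅ ⟶ A`: since `M(∅, -)` is terminal in `V`, the
pullback-hom reduces to `M(A, p)`. -/
theorem hasLiftingProperty_eHomWhiskerLeft {X Y : V} (j : X ⟶ Y) (A : M) {E E' : M} (p : E ⟶ E')
    [Cofibration j] [hA : IsCofibrant A] [Fibration p]
    (h : WeakEquivalence j ∨ WeakEquivalence p) :
    HasLiftingProperty j (eHomWhiskerLeft V A p) := by
  obtain ⟨C, hC⟩ := exists_enrichedInitial V M
  -- Enriched initiality tested on the unit object is ordinary initiality, so `C ⟶ A` is a
  -- cofibration.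
  have hom (Z : M) : Unique (C ⟶ Z) :=
    { default := (eHomEquiv V).symm (hC Z (𝟙_ V)).choose
      uniq g := (eHomEquiv V).injective (by
        rw [(hC Z (𝟙_ V)).choose_spec (eHomEquiv V g), Equiv.apply_symm_apply]) }
  have hC' : IsInitial C := IsInitial.ofUnique C
  have : Cofibration (hC'.to A) := (isCofibrant_iff_of_isInitial _ hC').1 hA
  refine ⟨fun {a c} sq => ?_⟩
  have ext {T : V} {Z : M} (f g : T ⟶ vhom V C Z) : f = g := by
    rw [(hC Z T).choose_spec f, (hC Z T).choose_spec g]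
  obtain ⟨l, h₁, -, h₂⟩ := exists_lift_pullbackHom j (hC'.to A) p (h.imp_left Or.inl) a
    (hC E Y).choose c (ext _ _) sq.w (ext _ _)
  exact ⟨⟨⟨l, h₁, h₂⟩⟩⟩

/-- This is the pullback-hom lifting property for `E ⟶ ⊤`: maps into `M(-, ⊤)` are unique, so the
conditions involving `⊤` are automatic. -/
theorem hasLiftingProperty_eHomWhiskerRight {X Y : V} (j : X ⟶ Y) {A B : M} (f : A ⟶ B) (E : M)
    [Cofibration j] [Cofibration f] [hE : IsFibrant E]
    (h : WeakEquivalence j ∨ WeakEquivalence f) :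
    HasLiftingProperty j (eHomWhiskerRight V f E) := by
  refine ⟨fun {a b} sq => ?_⟩
  -- The copower serves only to produce some map `Y ⟶ M(B, ⊤)`.
  obtain ⟨P⟩ := nonempty_copower Y B
  have term : IsTerminal (⊤_ M) := terminalIsTerminal
  obtain ⟨l, h₁, h₂, -⟩ := exists_lift_pullbackHom j f (terminal.from E) (Or.inl h) a b
    (P.unit ≫ eHomWhiskerLeft V B (terminal.from _)) sq.w (hom_terminal_ext term _ _)
    (hom_terminal_ext term _ _)
  exact ⟨⟨⟨l, h₁, h₂⟩⟩⟩

theorem trivialFibration_eHomWhiskerLeft (A : M) {E E' : M} (p : E ⟶ E')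
    [IsCofibrant A] [Fibration p] [hp : WeakEquivalence p] :
    Fibration (eHomWhiskerLeft V A p) ∧ WeakEquivalence (eHomWhiskerLeft V A p) :=
  trivialFibration_of_hasLiftingProperty _ fun j _ =>
    hasLiftingProperty_eHomWhiskerLeft j A p (Or.inr hp)

theorem trivialFibration_eHomWhiskerRight {A B : M} (f : A ⟶ B) (E : M)
    [Cofibration f] [hf : WeakEquivalence f] [IsFibrant E] :
    Fibration (eHomWhiskerRight V f E) ∧ WeakEquivalence (eHomWhiskerRight V f E) :=
  trivialFibration_of_hasLiftingProperty _ fun j _ =>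
    hasLiftingProperty_eHomWhiskerRight j f E (Or.inr hf)

theorem isFibrant_vhom (A E : M) [IsCofibrant A] [IsFibrant E] : IsFibrant (vhom V A E) := by
  have term : IsTerminal (vhom V A (⊤_ M)) :=
    IsTerminal.ofUniqueHom (fun T => (nonempty_copower T A).some.unit ≫
      eHomWhiskerLeft V A (terminal.from _)) fun _ _ => hom_terminal_ext terminalIsTerminal _ _
  rw [isFibrant_iff_of_isTerminal (eHomWhiskerLeft V A (terminal.from E)) term]
  exact fibration_of_hasLiftingProperty _ fun j _ hj =>
    hasLiftingProperty_eHomWhiskerLeft j A _ (Or.inl hj)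

end ModelLifting

end

end EnrichedHomotopy

namespace EnrichedHomotopy

noncomputable section

variable {V : Type u} [Category.{v} V] [MonoidalCategory V] [SymmetricCategory V]
  [MonoidalClosed V] [HasLimits V]

/-! ### The transformations `M(S, p)` and `M(p, S)` -/

section FunctorHom

variable {D : Type v} [EnrichedCategory V D] {M : Type u₂} [Category.{v₂} M]
  [EnrichedOrdinaryCategory V M]

theorem functorHom_presheafFunctor_app (S : EnrichedFunctor V D M) {X Y : M} (p : X ⟶ Y)
    (d : Dᵒᵖ) :
    (functorHom (presheafFunctor S) p).app d = eHomWhiskerLeft V (S.obj d.unop) p := by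
  apply (eHomEquiv V).injective
  refine (VNatTrans.eHomEquiv_ofElement_app _ d).trans ?_
  rw [Category.assoc, presheafFunctor_map_π]
  exact VNatTrans.eHomEquiv_comp_ecurry_eComp _ p

/-- The functor `M(-, S)` is covariant on `Mᵒᵖ`, with components the representables at `op (S d)`.
Its action on `p.op` is therefore postcomposition in `Mᵒᵖ`, that is, precomposition with `p` in `M`.
-/
theorem functorHom_copresheafFunctor_app (S : EnrichedFunctor V D M) {X Y : M} (p : X ⟶ Y)
    (d : D) :
    (functorHom (copresheafFunctor S) p.op).app d = eHomWhiskerRight V p (S.obj d) := by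
  apply (eHomEquiv V).injective
  rw [← eHomWhiskerLeft_op]
  refine (VNatTrans.eHomEquiv_ofElement_app _ d).trans ?_
  have h : (copresheafFunctor S).map (op Y) (op X) ≫ natObjπ _ _ d =
      ecurry (eComp V (op (S.obj d)) (op Y) (op X)) := homToMap_π S X Y d
  rw [Category.assoc, h]
  exact VNatTrans.eHomEquiv_comp_ecurry_eComp _ p.op

end FunctorHom

/-! ### Homotopy colimits and limits of bifibrant objects -/

variable [ModelCategory V] {M : Type u₂} [Category.{v₂} M] [EnrichedOrdinaryCategory V M]
  [ModelCategory M] {D : Type v} [EnrichedCategory V D]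

/-- A natural transformation in `M` restricts to the bifibrant objects. -/
def restrictWeightedCocones {G : EnrichedFunctor V Dᵒᵖ V}
    {S : EnrichedFunctor V D (BifibrantObject M)} {R : BifibrantObject M}
    (β : VNatTrans (corep R.obj) (weightedCocones G (toAmbient S))) :
    VNatTrans (corep R) (weightedCocones G S) where
  app A := β.app A.obj
  naturality A B := β.naturality A.obj B.obj

/-- A natural transformation in `Mᵒᵖ` restricts to the bifibrant objects. -/
def restrictWeightedCones {G : EnrichedFunctor V D V}
    {S : EnrichedFunctor V D (BifibrantObject M)} {Q : BifibrantObject M}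
    (β : VNatTrans (corep (op Q.obj)) (weightedCones G (toAmbient S))) :
    VNatTrans (corep (op Q)) (weightedCones G S) where
  app A := β.app (op A.unop.obj)
  naturality A B := β.naturality (op A.unop.obj) (op B.unop.obj)

instance (A : BifibrantObject M) : IsCofibrant A.obj := A.property.1

instance (A : BifibrantObject M) : IsFibrant A.obj := A.property.2

variable [ModelEnrichedCategory V M]

/-- A colimit of cofibrant objects weighted by a cofibrant weight is cofibrant. -/
theorem isCofibrant_of_isWeightedColimit {G : EnrichedFunctor V Dᵒᵖ V}
    (hG : IsCofibrantWeight G) (S : EnrichedFunctor V D M) (hS : ∀ d, IsCofibrant (S.obj d)) {C : M}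
    (β : VNatTrans (corep C) (weightedCocones G S)) (hβ : IsWeightedColimit β) :
    IsCofibrant C := by
  rw [isCofibrant_iff, cofibration_iff, ← trivialFibrations_llp]
  intro X Y p hp
  obtain ⟨_, _⟩ := (mem_trivialFibrations_iff p).1 hp
  refine ⟨fun {f c} sq => ?_⟩
  -- Only the lower triangle needs an argument, the upper one starting at the initial object. The
  -- lift exists because each `M(S d, p)` is a trivial fibration, `S d` being cofibrant.
  obtain ⟨l, hl⟩ := exists_lift_of_isCofibrantWeight (presheafFunctor S) hG β hβ p (fun d => by
    have := hS d.unop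
    rw [functorHom_presheafFunctor_app]
    exact trivialFibration_eHomWhiskerLeft _ p) c
  exact ⟨⟨⟨l, initialIsInitial.hom_ext _ _, hl⟩⟩⟩

/-- A limit of fibrant objects weighted by a cofibrant weight is fibrant. -/
theorem isFibrant_of_isWeightedLimit {G : EnrichedFunctor V D V}
    (hG : IsCofibrantWeight G) (S : EnrichedFunctor V D M) (hS : ∀ d, IsFibrant (S.obj d)) {L : M}
    (β : VNatTrans (corep (op L)) (weightedCones G S)) (hβ : IsWeightedLimit β) :
    IsFibrant L := by
  rw [isFibrant_iff, fibration_iff, ← trivialCofibrations_rlp]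
  intro X Y j hj
  obtain ⟨_, _⟩ := (mem_trivialCofibrations_iff j).1 hj
  refine ⟨fun {c f} sq => ?_⟩
  -- Extending `c : X ⟶ L` along `j` in `M` is lifting `c.op` through `j.op` in `Mᵒᵖ`; each `M(j, S
  -- d)` is a trivial fibration because `S d` is fibrant.
  obtain ⟨l, hl⟩ := exists_lift_of_isCofibrantWeight (copresheafFunctor S) hG β hβ j.op
    (fun d => by
      have := hS d
      rw [functorHom_copresheafFunctor_app]
      exact trivialFibration_eHomWhiskerRight j _) c.op
  exact ⟨⟨⟨l.unop, congrArg Quiver.Hom.unop hl, terminalIsTerminal.hom_ext _ _⟩⟩⟩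

/-- Cofibrancy passes from `C` to `R` along `r`. The comparison map is `M(r, A)`, a trivial
fibration since `A` is fibrant, followed by an isomorphism. Its naturality restricts from `M`
because the hom-objects of the full subcategory are those of `M`. -/
theorem exists_isHomotopyColimit {G : EnrichedFunctor V Dᵒᵖ V} (hG : IsCofibrantWeight G)
    (S : EnrichedFunctor V D (BifibrantObject M)) {C : M}
    (β : VNatTrans (corep C) (weightedCocones G (toAmbient S))) (hβ : IsWeightedColimit β)
    {R : M} (r : C ⟶ R) [Cofibration r] [WeakEquivalence r] [hR : IsFibrant R] :
    ∃ (hR : bifibrantObjects M R)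
      (γ : VNatTrans (corep (⟨R, hR⟩ : BifibrantObject M)) (weightedCocones G S)),
      (∀ A : BifibrantObject M, γ.app A = eHomWhiskerRight V r A.obj ≫ β.app A.obj) ∧
      IsHomotopyColimit γ := by
  have hC : IsCofibrant C := isCofibrant_of_isWeightedColimit hG (toAmbient S)
    (fun d => (S.obj d).property.1) β hβ
  refine ⟨⟨isCofibrant_of_cofibration r, hR⟩,
    restrictWeightedCocones ((VNatTrans.corepMap r).comp β), fun A => rfl, fun A => ?_⟩
  have h₁ : WeakEquivalence (eHomWhiskerRight V r A.obj) :=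
    (trivialFibration_eHomWhiskerRight r A.obj).2
  have h₂ : IsIso (β.app A.obj) := hβ A.obj
  have h₃ : WeakEquivalence (β.app A.obj) := inferInstance
  exact inferInstanceAs (WeakEquivalence (eHomWhiskerRight V r A.obj ≫ β.app A.obj))

/-- Dually, fibrancy passes from `L` to `Q` along `q`, and `M(A, q)` is a trivial fibration since
`A` is cofibrant. -/
theorem exists_isHomotopyLimit {G : EnrichedFunctor V D V} (hG : IsCofibrantWeight G)
    (S : EnrichedFunctor V D (BifibrantObject M)) {L : M}
    (β : VNatTrans (corep (op L)) (weightedCones G (toAmbient S))) (hβ : IsWeightedLimit β)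
    {Q : M} (q : Q ⟶ L) [Fibration q] [WeakEquivalence q] [hQ : IsCofibrant Q] :
    ∃ (hQ : bifibrantObjects M Q)
      (γ : VNatTrans (corep (op (⟨Q, hQ⟩ : BifibrantObject M))) (weightedCones G S)),
      (∀ A : BifibrantObject M, γ.app (op A) = eHomWhiskerLeft V A.obj q ≫ β.app (op A.obj)) ∧
      IsHomotopyLimit γ := by
  have hL : IsFibrant L := isFibrant_of_isWeightedLimit hG (toAmbient S)
    (fun d => (S.obj d).property.2) β hβ
  let γ := (VNatTrans.corepMap q.op).comp β
  have hγ (A : BifibrantObject M) :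
      γ.app (op A.obj) = eHomWhiskerLeft V A.obj q ≫ β.app (op A.obj) := by
    rw [← eHomWhiskerRight_op]
    rfl
  refine ⟨⟨hQ, isFibrant_of_fibration q⟩, restrictWeightedCones γ, hγ, fun A => ?_⟩
  have h₁ : WeakEquivalence (eHomWhiskerLeft V A.unop.obj q) :=
    (trivialFibration_eHomWhiskerLeft A.unop.obj q).2
  have h₂ : IsIso (β.app (op A.unop.obj)) := hβ (op A.unop.obj)
  have h₃ : WeakEquivalence (β.app (op A.unop.obj)) := inferInstance
  have h₄ : WeakEquivalence (γ.app (op A.unop.obj)) := by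
    rw [hγ]
    infer_instance
  exact h₄

end

end EnrichedHomotopy

theorem mainTheorem11 {V : Type u} [Category.{v} V] [MonoidalCategory V] [SymmetricCategory V]
    [MonoidalClosed V] [HasLimits V] [HasColimits V] [ModelCategory V] [MonoidalModelCategory V]
    [MonoidAxiom V] {M : Type u₂} [Category.{v₂} M] [EnrichedOrdinaryCategory V M]
    [ModelCategory M] [ModelEnrichedCategory V M] :
    IsFibrantEnriched V (BifibrantObject M) ∧
    HasWeightedHomotopyColimits V (BifibrantObject M) ∧
    HasWeightedHomotopyLimits V (BifibrantObject M) ∧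
    (∀ (D : Type v) [EnrichedCategory V D] (G : EnrichedFunctor V Dᵒᵖ V)
      (S : EnrichedFunctor V D (BifibrantObject M)), IsCofibrantWeight G →
      ∀ (C : M) (β : VNatTrans (corep C) (weightedCocones G (toAmbient S))), IsWeightedColimit β →
      ∀ (R : M) (r : C ⟶ R), Cofibration r → WeakEquivalence r → IsFibrant R →
        ∃ (hR : bifibrantObjects M R)
          (γ : VNatTrans (corep (⟨R, hR⟩ : BifibrantObject M)) (weightedCocones G S)),
          (∀ A : BifibrantObject M, γ.app A = eHomWhiskerRight V r A.obj ≫ β.app A.obj) ∧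
          IsHomotopyColimit γ) ∧
    (∀ (D : Type v) [EnrichedCategory V D] (G : EnrichedFunctor V D V)
      (S : EnrichedFunctor V D (BifibrantObject M)), IsCofibrantWeight G →
      ∀ (L : M) (β : VNatTrans (corep (op L)) (weightedCones G (toAmbient S))), IsWeightedLimit β →
      ∀ (Q : M) (q : Q ⟶ L), Fibration q → WeakEquivalence q → IsCofibrant Q →
        ∃ (hQ : bifibrantObjects M Q)
          (γ : VNatTrans (corep (op (⟨Q, hQ⟩ : BifibrantObject M))) (weightedCones G S)),
          (∀ A : BifibrantObject M, γ.app (op A) = eHomWhiskerLeft V A.obj q ≫ β.app (op A.obj)) ∧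
          IsHomotopyLimit γ) := by
  refine ⟨fun X Y => isFibrant_vhom X.obj Y.obj, fun D _ G S hG => ?_, fun D _ G S hG => ?_,
    fun D _ G S hG C β hβ R r _ _ _ => exists_isHomotopyColimit hG S β hβ r,
    fun D _ G S hG L β hβ Q q _ _ _ => exists_isHomotopyLimit hG S β hβ q⟩
  · obtain ⟨C, β, hβ⟩ := ModelEnrichedCategory.exists_weightedColimit D G (toAmbient S)
    -- Fibrant replacement of the weighted colimit; its first factor plays the role of `r`.
    let h := MorphismProperty.factorizationData (trivialCofibrations M) (fibrations M)
      (terminal.from C)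
    obtain ⟨_, _⟩ := (mem_trivialCofibrations_iff h.i).1 h.hi
    have : IsFibrant h.Z :=
      (isFibrant_iff_of_isTerminal h.p terminalIsTerminal).2 ((fibration_iff _).2 h.hp)
    obtain ⟨_, γ, -, hγ⟩ := exists_isHomotopyColimit hG S β hβ h.i
    exact ⟨_, γ, hγ⟩
  · obtain ⟨L, β, hβ⟩ := ModelEnrichedCategory.exists_weightedLimit D G (toAmbient S)
    -- Cofibrant replacement of the weighted limit; its second factor plays the role of `q`.
    let h := MorphismProperty.factorizationData (cofibrations M) (trivialFibrations M)
      (initial.to L)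
    obtain ⟨_, _⟩ := (mem_trivialFibrations_iff h.p).1 h.hp
    have : IsCofibrant h.Z :=
      (isCofibrant_iff_of_isInitial h.i initialIsInitial).2 ((cofibration_iff _).2 h.hi)
    obtain ⟨_, γ, -, hγ⟩ := exists_isHomotopyLimit hG S β hβ h.p
    exact ⟨_, γ, hγ⟩
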